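/- Let $N\ge 1$, $\mathcal H_A=\mathcal H_B=\mathbb C^N$. Let $\mathcal E_A,\mathcal E_B$ be quantum channels (CPTP maps given by finite Kraus families) on operators on $\mathcal H_A$, $\mathcal H_B$, let $\mathcal M_a$ and $\mathcal M_b$ be elements of finite POVMs on $\mathcal H_A$ and $\mathcal H_B$, and put $\mathcal K_a=\mathcal E_A^\dagger(\mathcal M_a)$, $\mathcal K_b=\mathcal E_B^\dagger(\mathcal M_b)$, $\mathcal K_\phi=\mathcal K_a\otimes\mathcal K_b$. For real $s$ let $\mathbb H_s$ be the set of pure states of $\mathcal H_A\otimes\mathcal H_B$ whose entanglement entropy (the von Neumann entropy, with natural logarithm, of the reduced state on $\mathcal H_A$) is at least $s$, and let $$J_{\max}(\mathcal K_\phi,s)=\max_{|\psi\rangle\in\mathbb H_s}\langle\psi|\mathcal K_\phi|\psi\rangle .$$ Let $\alpha_1\ge\dots\ge\alpha_N\ge 0$ and $\beta_1\ge\dots\ge\beta_N\ge 0$ be the eigenvalues of $\mathcal K_a$ and $\mathcal K_b$ with multiplicity, $\mu_j=\alpha_j\beta_j$, $d_{\max}=\#\{j:\mu_j=\mu_1\}$,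 let $\sigma_{\max}(\mathcal K_\phi)$ be the largest eigenvalue of $\mathcal K_\phi$, and $Z(\gamma)=\sum_{j=1}^N e^{\gamma\mu_j}$. Say that a probability vector $\lambda\in\mathbb R^N$ is optimal for $s$ if for all orthonormal eigenbases $(a_j)$ of $\mathcal K_a$ and $(b_j)$ of $\mathcal K_b$ ordered as the $\alpha_j$ and $\beta_j$, the state $\sum_j\sqrt{\lambda_j}\,a_j\otimes b_j$ lies in $\mathbb H_s$ and attains $J_{\max}(\mathcal K_\phi,s)$. For every $s\le\log N$ the maximum defining $J_{\max}(\mathcal K_\phi,s)$ exists, and the following hold. (i) If $s\le\log d_{\max}$, then $J_{\max}(\mathcal K_\phi,s)=\mu_1=\sigma_{\max}(\mathcal K_\phi)$, and the vector with $\lambda_j=1/d_{\max}$ for $j\le d_{\max}$ and $\lambda_j=0$ for $j>d_{\max}$ is optimal for $s$. (ii) If $\log d_{\max}<s\le\log N$, then the entropy equation $$\log Z(\gamma)-\frac{\gamma}{Z(\gamma)}\sum_{j=1}^N\mu_je^{\gamma\mu_j}=s$$ has a unique solution $\gamma\ge 0$; one has $\gamma>0$ if and only if $s<\log N$. Moreover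 $$J_{\max}(\mathcal K_\phi,s)=\frac1{Z(\gamma)}\sum_{j=1}^N\mu_je^{\gamma\mu_j}<\sigma_{\max}(\mathcal K_\phi),$$ and the Gibbs vector $\lambda_j=e^{\gamma\mu_j}/Z(\gamma)$ is optimal for $s$. (iii) $s\mapsto J_{\max}(\mathcal K_\phi,s)$ is strictly decreasing on $[\log d_{\max},\log N]$. -/

import Mathlib

open scoped Matrix Kronecker ComplexOrder

namespace PrivacyEnergy

noncomputable section

/-- Operators on the Hilbert space `ℂ^ι` (`ι = Fin N` for one subsystem, `Fin N × Fin N` for the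
composite system), in the standard basis. -/
abbrev Op (ι : Type*) := Matrix ι ι ℂ

/-- A quantum channel (CPTP map) on operators on `ℂ^N`, given by a finite Kraus family. -/
structure QuantumChannel (κ : Type*) [Fintype κ] (N : ℕ) where
  kraus : κ → Op (Fin N)
  sum_adjoint_mul : ∑ k, (kraus k)ᴴ * kraus k = 1

/-- The action `ρ ↦ ∑ E_k ρ E_k†` of the channel. -/
def QuantumChannel.apply {κ : Type*} [Fintype κ] {N : ℕ} (E : QuantumChannel κ N)
    (ρ : Op (Fin N)) : Op (Fin N) :=
  ∑ k, E.kraus k * ρ * (E.kraus k)ᴴ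

/-- The adjoint map `M ↦ ∑ E_k† M E_k` of the channel. -/
def QuantumChannel.adjoint {κ : Type*} [Fintype κ] {N : ℕ} (E : QuantumChannel κ N)
    (M : Op (Fin N)) : Op (Fin N) :=
  ∑ k, (E.kraus k)ᴴ * M * E.kraus k

/-- `adjoint` is the adjoint of `apply` for the trace pairing. -/
theorem QuantumChannel.trace_mul_apply {κ : Type*} [Fintype κ] {N : ℕ} (E : QuantumChannel κ N)
    (M ρ : Op (Fin N)) : (M * E.apply ρ).trace = (E.adjoint M * ρ).trace := by
  simp only [QuantumChannel.apply, QuantumChannel.adjoint, Finset.mul_sum, Finset.sum_mul,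
    Matrix.trace_sum]
  refine Finset.sum_congr rfl fun k _ => ?_
  rw [← Matrix.mul_assoc, Matrix.trace_mul_comm]
  simp only [Matrix.mul_assoc]

/-- A POVM with finite outcome set `O` on `ℂ^N`. -/
structure POVM (O : Type*) [Fintype O] (N : ℕ) where
  elem : O → Op (Fin N)
  posSemidef : ∀ o, (elem o).PosSemidef
  sum_elem : ∑ o, elem o = 1

/-- The induced local observable `K_o = E†(M_o)`. -/
def inducedObservable {κ O : Type*} [Fintype κ] [Fintype O] {N : ℕ}
    (E : QuantumChannel κ N) (M : POVM O N) (o : O) : Op (Fin N) :=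
  E.adjoint (M.elem o)

theorem isHermitian_inducedObservable {κ O : Type*} [Fintype κ] [Fintype O] {N : ℕ}
    (E : QuantumChannel κ N) (M : POVM O N) (o : O) :
    (inducedObservable E M o).IsHermitian := by
  have h := (M.posSemidef o).isHermitian.eq
  simp only [Matrix.IsHermitian, inducedObservable, QuantumChannel.adjoint,
    Matrix.conjTranspose_sum, Matrix.conjTranspose_mul, Matrix.conjTranspose_conjTranspose, h,
    Matrix.mul_assoc]

/-- The `j`-th largest eigenvalue (with multiplicity, `j` counted from `0`). -/
def sortedEigenvalue {N : ℕ} {K : Op (Fin N)} (hK : K.IsHermitian) (j : Fin N) : ℝ :=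
  hK.eigenvalues₀ (Fin.cast (Fintype.card_fin N).symm j)

/-- The largest eigenvalue of a Hermitian operator. -/
def sigmaMax {ι : Type*} [Fintype ι] [DecidableEq ι] (K : Op ι) : ℝ :=
  sSup (spectrum ℝ K)

/-- The partial trace over the second subsystem. -/
def partialTraceB {N : ℕ} (ρ : Op (Fin N × Fin N)) : Op (Fin N) :=
  Matrix.of fun i i' => ∑ j, ρ (i, j) (i', j)

theorem isHermitian_partialTraceB {N : ℕ} {ρ : Op (Fin N × Fin N)} (hρ : ρ.IsHermitian) :
    (partialTraceB ρ).IsHermitian := by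
  ext i i'
  simp only [partialTraceB, Matrix.conjTranspose_apply, Matrix.of_apply, star_sum]
  exact Finset.sum_congr rfl fun j _ => hρ.apply _ _

/-- The von Neumann entropy `-∑ λ_j log λ_j` over the eigenvalues (natural logarithm). -/
def vonNeumannEntropy {N : ℕ} {ρ : Op (Fin N)} (hρ : ρ.IsHermitian) : ℝ :=
  -∑ j, hρ.eigenvalues j * Real.log (hρ.eigenvalues j)

/-- The entanglement entropy: von Neumann entropy of the reduced state on the first subsystem. -/
def entanglementEntropy {N : ℕ} {ρ : Op (Fin N × Fin N)} (hρ : ρ.IsHermitian) : ℝ :=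
  vonNeumannEntropy (isHermitian_partialTraceB hρ)

/-- `ℍ_s`: pure (rank-one) density operators with entanglement entropy at least `s`. -/
def pureStates (N : ℕ) (s : ℝ) : Set (Op (Fin N × Fin N)) :=
  {ρ | ∃ hρ : ρ.PosSemidef, ρ.trace = 1 ∧ ρ.rank = 1 ∧ s ≤ entanglementEntropy hρ.isHermitian}

/-- The kets `ψ` whose projector `|ψ⟩⟨ψ|` lies in `ℍ_s`. -/
def kets (N : ℕ) (s : ℝ) : Set (EuclideanSpace ℂ (Fin N × Fin N)) :=
  {ψ | Matrix.vecMulVec ψ.ofLp (star ψ.ofLp) ∈ pureStates N s}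

/-- The privacy energy `⟨ψ|K|ψ⟩` (a real number for Hermitian `K`). -/
def energy {ι : Type*} [Fintype ι] (K : Op ι) (ψ : EuclideanSpace ℂ ι) : ℝ :=
  (star ψ.ofLp ⬝ᵥ (K *ᵥ ψ.ofLp)).re

/-- The maximal privacy energy over `ℍ_s`. -/
def Jmax {N : ℕ} (K : Op (Fin N × Fin N)) (s : ℝ) : ℝ :=
  sSup (energy K '' kets N s)

/-- The number of indices `j` with `μ_j` equal to the first entry of `μ`. -/
def dMax {N : ℕ} [NeZero N] (μ : Fin N → ℝ) : ℕ :=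
  (Finset.univ.filter fun j : Fin N => μ j = μ 0).card

/-- The partition function `Z(γ) = ∑ e^{γ μ_j}`. -/
def Z {N : ℕ} (μ : Fin N → ℝ) (γ : ℝ) : ℝ :=
  ∑ j, Real.exp (γ * μ j)

/-- The entropy equation for `γ`. -/
def EntropyEq {N : ℕ} (μ : Fin N → ℝ) (s γ : ℝ) : Prop :=
  Real.log (Z μ γ) - γ / Z μ γ * ∑ j, μ j * Real.exp (γ * μ j) = s

/-- `a` is an orthonormal basis of eigenvectors of `K`, in decreasing order of the eigenvalues. -/
def IsSortedEigenbasis {N : ℕ} {K : Op (Fin N)} (hK : K.IsHermitian)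
    (a : OrthonormalBasis (Fin N) ℂ (EuclideanSpace ℂ (Fin N))) : Prop :=
  ∀ j, K *ᵥ (a j).ofLp = (sortedEigenvalue hK j : ℂ) • (a j).ofLp

/-- The state `∑ √λ_j |a_j⟩ ⊗ |b_j⟩`. -/
def schmidtState {N : ℕ} (a b : OrthonormalBasis (Fin N) ℂ (EuclideanSpace ℂ (Fin N)))
    (lam : Fin N → ℝ) : EuclideanSpace ℂ (Fin N × Fin N) :=
  WithLp.toLp 2 fun p => ∑ j, (Real.sqrt (lam j) : ℂ) * (a j p.1 * b j p.2)

/-- The Schmidt weights `lam`, in sorted eigenbases of `Ka` and `Kb` (that is, without further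
local rotations), give a state of `ℍ_s` that maximizes the energy of `Ka ⊗ Kb` over `ℍ_s`. -/
def IsOptimalWeight {N : ℕ} {Ka Kb : Op (Fin N)} (hKa : Ka.IsHermitian) (hKb : Kb.IsHermitian)
    (s : ℝ) (lam : Fin N → ℝ) : Prop :=
  (∀ j, 0 ≤ lam j) ∧ ∑ j, lam j = 1 ∧
  ∀ a b : OrthonormalBasis (Fin N) ℂ (EuclideanSpace ℂ (Fin N)),
    IsSortedEigenbasis hKa a → IsSortedEigenbasis hKb b →
      schmidtState a b lam ∈ kets N s ∧
        IsMaxOn (energy (Ka ⊗ₖ Kb)) (kets N s) (schmidtState a b lam)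

end

end PrivacyEnergy

namespace PrivacyEnergy

open Real Filter Topology

/-! The quantum problem reduces to a classical one. Let Y be the coefficient matrix of a ket in a
product of sorted eigenbases of the two observables. The energy is ∑ α_i β_j |Y_ji|², and the row
and column sums of |Y_ji|² are the diagonals of Y Yᴴ and Yᴴ Y, both of which have the Schmidt
weights as spectrum. Schur's inequality (`sum_diag_le_sum_sortedEigenvalue`) bounds the leading sums
of these diagonals, and Abel summation in both indices (`sum_mul_mul_le_of_partial_sums`) turns this
into energy ≤ ∑ λ_j μ_j, with λ the sorted Schmidt weights. The states `schmidtState` realize such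
means exactly, so it remains to maximize the mean of μ over probability vectors of Shannon entropy
at least s (`isOptimalWeight_of_maximizes`).

Up to entropy log d, where d = `dMax μ`, the uniform vector on the top indices has the largest
conceivable mean. Beyond that, the variational principle S(λ) + γ ∑ λ_j μ_j ≤ log Z(γ), with
equality only at the Gibbs vector, makes each Gibbs vector with γ ≥ 0 optimal at its own entropy.
Its equality case also shows that this entropy determines γ ≥ 0 when μ is not constant. The entropy
is continuous in γ, equal to log N at 0 and tending to log d at infinity, so every intermediate s
occurs. -/

/-- The Gibbs weights `e^{γ μ_j} / Z(γ)`. -/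
noncomputable def gibbs {N : ℕ} (μ : Fin N → ℝ) (γ : ℝ) (j : Fin N) : ℝ :=
  exp (γ * μ j) / Z μ γ

/-- The Shannon entropy `-∑ λ_j log λ_j` of a weight vector. -/
noncomputable def shannon {N : ℕ} (l : Fin N → ℝ) : ℝ := ∑ j, negMulLog (l j)

/-! ### Gibbs vectors and their variational principle -/

section Gibbs

variable {N : ℕ} (μ : Fin N → ℝ)

theorem Z_zero : Z μ 0 = N := by simp [Z]

theorem sum_gibbs_mul (γ : ℝ) :
    ∑ j, gibbs μ γ j * μ j = 1 / Z μ γ * ∑ j, μ j * exp (γ * μ j) := by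
  rw [Finset.mul_sum]
  refine Finset.sum_congr rfl fun j _ => ?_
  simp only [gibbs]
  ring

variable [NeZero N]

theorem Z_pos (γ : ℝ) : 0 < Z μ γ :=
  Finset.sum_pos (fun _ _ => exp_pos _) ⟨0, Finset.mem_univ _⟩

theorem gibbs_pos (γ : ℝ) (j : Fin N) : 0 < gibbs μ γ j :=
  div_pos (exp_pos _) (Z_pos μ γ)

theorem sum_gibbs (γ : ℝ) : ∑ j, gibbs μ γ j = 1 := by
  simp only [gibbs, ← Finset.sum_div]
  exact div_self (Z_pos μ γ).ne'

theorem log_gibbs (γ : ℝ) (j : Fin N) : log (gibbs μ γ j) = γ * μ j - log (Z μ γ) := by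
  rw [gibbs, log_div (exp_pos _).ne' (Z_pos μ γ).ne', log_exp]

theorem shannon_gibbs (γ : ℝ) :
    shannon (gibbs μ γ) = log (Z μ γ) - γ * ∑ j, gibbs μ γ j * μ j := by
  have h : ∀ j, negMulLog (gibbs μ γ j)
      = gibbs μ γ j * log (Z μ γ) - γ * (gibbs μ γ j * μ j) := fun j => by
    rw [negMulLog, log_gibbs]; ring
  simp only [shannon, h, Finset.sum_sub_distrib, ← Finset.sum_mul, ← Finset.mul_sum, sum_gibbs,
    one_mul]

theorem entropyEq_iff (s γ : ℝ) : EntropyEq μ s γ ↔ shannon (gibbs μ γ) = s := by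
  rw [EntropyEq, shannon_gibbs, sum_gibbs_mul]
  ring_nf

variable {μ} {l : Fin N → ℝ}

/-- The inequality -t log t < 1 - t for t ≠ 1, taken at t = x / p and multiplied by p. Summed over
the entries of two probability vectors, it is the positivity of relative entropy. -/
theorem negMulLog_add_mul_log_lt {x p : ℝ} (hx : 0 ≤ x) (hp : 0 < p) (h : x ≠ p) :
    negMulLog x + x * log p < p - x := by
  have h1 : negMulLog (x / p) < 1 - x / p :=
    negMulLog_lt_one_sub_self (by positivity) (by rwa [Ne, div_eq_one_iff_eq hp.ne'])
  have h2 := negMulLog_mul p (x / p)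
  rw [mul_div_cancel₀ _ hp.ne'] at h2
  have h3 : x / p * negMulLog p = -(x * log p) := by
    rw [negMulLog]; field_simp
  have h4 := mul_lt_mul_of_pos_left h1 hp
  have h5 : p * (1 - x / p) = p - x := by field_simp
  linarith

theorem negMulLog_add_mul_log_le {x p : ℝ} (hx : 0 ≤ x) (hp : 0 < p) :
    negMulLog x + x * log p ≤ p - x := by
  rcases eq_or_ne x p with rfl | h
  · rw [negMulLog]; linarith
  · exact (negMulLog_add_mul_log_lt hx hp h).le

/-- The logarithm of a Gibbs weight is affine in μ, so minus the relative entropy to the Gibbs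
vector is the defect in the variational principle. -/
theorem sum_negMulLog_add_mul_log_gibbs (h1 : ∑ j, l j = 1) (γ : ℝ) :
    ∑ j, (negMulLog (l j) + l j * log (gibbs μ γ j))
      = shannon l + γ * ∑ j, l j * μ j - log (Z μ γ) := by
  simp only [log_gibbs, mul_sub, Finset.sum_add_distrib, Finset.sum_sub_distrib,
    ← Finset.sum_mul, h1, one_mul, shannon, Finset.mul_sum]
  rw [add_sub_assoc]
  congr 2
  exact Finset.sum_congr rfl fun j _ => by ring

/-- The Gibbs variational principle. -/
theorem shannon_add_le_log_Z (h0 : ∀ j, 0 ≤ l j) (h1 : ∑ j, l j = 1) (γ : ℝ) :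
    shannon l + γ * ∑ j, l j * μ j ≤ log (Z μ γ) := by
  have := Finset.sum_le_sum fun j (_ : j ∈ Finset.univ) =>
    negMulLog_add_mul_log_le (h0 j) (gibbs_pos μ γ j)
  rw [sum_negMulLog_add_mul_log_gibbs h1, Finset.sum_sub_distrib, sum_gibbs, h1] at this
  linarith

/-- The Gibbs weights are the only maximizers in the Gibbs variational principle. -/
theorem eq_gibbs_of_log_Z_le (h0 : ∀ j, 0 ≤ l j) (h1 : ∑ j, l j = 1) {γ : ℝ}
    (h : log (Z μ γ) ≤ shannon l + γ * ∑ j, l j * μ j) : l = gibbs μ γ := by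
  by_contra hne
  obtain ⟨i, hi⟩ := Function.ne_iff.1 hne
  have := Finset.sum_lt_sum (fun j (_ : j ∈ Finset.univ) =>
    negMulLog_add_mul_log_le (h0 j) (gibbs_pos μ γ j))
    ⟨i, Finset.mem_univ _, negMulLog_add_mul_log_lt (h0 i) (gibbs_pos μ γ i) hi⟩
  rw [sum_negMulLog_add_mul_log_gibbs h1, Finset.sum_sub_distrib, sum_gibbs, h1] at this
  linarith

/-- Among weights with at least the entropy of the Gibbs weights, the latter maximize the mean. -/
theorem sum_mul_le_of_shannon_le (h0 : ∀ j, 0 ≤ l j) (h1 : ∑ j, l j = 1) {γ : ℝ} (hγ : 0 ≤ γ)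
    (h : shannon (gibbs μ γ) ≤ shannon l) : ∑ j, l j * μ j ≤ ∑ j, gibbs μ γ j * μ j := by
  have hv := shannon_add_le_log_Z (μ := μ) h0 h1 γ
  have hg := shannon_gibbs μ γ
  -- For γ = 0 there is no factor to cancel. Instead `l` attains the variational bound and is
  -- therefore the Gibbs vector itself.
  rcases hγ.eq_or_lt with rfl | hpos
  · have : l = gibbs μ 0 := eq_gibbs_of_log_Z_le h0 h1 (by linarith)
    rw [this]
  · exact le_of_mul_le_mul_left (by linarith) hpos

theorem sum_mul_lt_of_shannon_lt (h0 : ∀ j, 0 ≤ l j) (h1 : ∑ j, l j = 1) {γ : ℝ} (hγ : 0 < γ)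
    (h : shannon (gibbs μ γ) < shannon l) : ∑ j, l j * μ j < ∑ j, gibbs μ γ j * μ j := by
  have hv := shannon_add_le_log_Z (μ := μ) h0 h1 γ
  have hg := shannon_gibbs μ γ
  exact lt_of_mul_lt_mul_left (by linarith) hγ.le

/-- The ratio of the weights at i and j is e^{γ(μ_i - μ_j)}: the normalization cancels. -/
theorem gibbs_injective {i j : Fin N} (hij : μ i ≠ μ j) : Function.Injective (gibbs μ) := by
  intro γ γ' h
  have hi := congrArg log (congrFun h i)
  have hj := congrArg log (congrFun h j)
  rw [log_gibbs, log_gibbs] at hi hj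
  have : (γ - γ') * (μ i - μ j) = 0 := by linarith
  rcases mul_eq_zero.1 this with h | h
  · linarith
  · exact absurd (by linarith) hij

/-- Two Gibbs vectors of equal entropy each bound the other's mean, so the means agree. Then one
attains equality in the variational principle of the other, and they coincide. No derivative of the
entropy is needed. -/
theorem shannon_gibbs_injOn {i j : Fin N} (hij : μ i ≠ μ j) :
    Set.InjOn (fun γ => shannon (gibbs μ γ)) (Set.Ici 0) := by
  intro γ hγ γ' hγ' h
  wlog hlt : γ ≤ γ' generalizing γ γ'
  · exact (this hγ' hγ h.symm (le_of_not_ge hlt)).symm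
  simp only [Set.mem_Ici] at hγ hγ' h
  have h0 : ∀ γ j, 0 ≤ gibbs μ γ j := fun γ j => (gibbs_pos μ γ j).le
  have h1 := sum_mul_le_of_shannon_le (μ := μ) (h0 γ) (sum_gibbs μ γ) hγ' h.ge
  have h2 := sum_mul_le_of_shannon_le (μ := μ) (h0 γ') (sum_gibbs μ γ') hγ h.le
  have h3 := le_antisymm h1 h2
  refine gibbs_injective hij ?_
  refine (eq_gibbs_of_log_Z_le (h0 γ) (sum_gibbs μ γ) ?_)
  rw [h, h3, shannon_gibbs]
  linarith

theorem shannon_gibbs_zero : shannon (gibbs μ 0) = log N := by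
  rw [shannon_gibbs, Z_zero]; simp

theorem sum_gibbs_mul_lt {c : ℝ} (hc : ∀ j, μ j ≤ c) {i : Fin N} (hi : μ i < c) (γ : ℝ) :
    ∑ j, gibbs μ γ j * μ j < c := by
  calc ∑ j, gibbs μ γ j * μ j < ∑ j, gibbs μ γ j * c :=
        Finset.sum_lt_sum (fun j _ => mul_le_mul_of_nonneg_left (hc j) (gibbs_pos μ γ j).le)
          ⟨i, Finset.mem_univ _, mul_lt_mul_of_pos_left hi (gibbs_pos μ γ i)⟩
    _ = c := by rw [← Finset.sum_mul, sum_gibbs, one_mul]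

theorem continuous_shannon_gibbs : Continuous fun γ => shannon (gibbs μ γ) := by
  unfold shannon gibbs
  refine continuous_finsetSum _ fun j _ => continuous_negMulLog.comp ?_
  refine Continuous.div (by fun_prop) ?_ fun γ => (Z_pos μ γ).ne'
  unfold Z
  fun_prop

/-! ### The limit γ → ∞ and solvability of the entropy equation -/

theorem dMax_pos : 0 < dMax μ :=
  Finset.card_pos.2 ⟨0, by simp⟩

theorem sum_ite_top (c : ℝ) : ∑ j, (if μ j = μ 0 then c else 0) = dMax μ * c := by
  rw [← Finset.sum_filter, Finset.sum_const, nsmul_eq_mul, dMax]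

theorem shannon_top :
    shannon (fun j => if μ j = μ 0 then 1 / (dMax μ : ℝ) else 0) = log (dMax μ) := by
  have hd : (0 : ℝ) < dMax μ := by exact_mod_cast dMax_pos (μ := μ)
  have : ∀ j, negMulLog (if μ j = μ 0 then 1 / (dMax μ : ℝ) else 0)
      = if μ j = μ 0 then negMulLog (1 / (dMax μ : ℝ)) else 0 := fun j => by
    split_ifs <;> simp
  simp only [shannon, this, sum_ite_top]
  rw [negMulLog, one_div, log_inv]
  field_simp

theorem tendsto_gibbs_atTop (hμ : ∀ j, μ j ≤ μ 0) (j : Fin N) :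
    Tendsto (fun γ => gibbs μ γ j) atTop (𝓝 (if μ j = μ 0 then 1 / (dMax μ : ℝ) else 0)) := by
  have hd : (0 : ℝ) < dMax μ := by exact_mod_cast dMax_pos (μ := μ)
  have hexp : ∀ i, Tendsto (fun γ => exp (γ * (μ i - μ 0))) atTop
      (𝓝 (if μ i = μ 0 then 1 else 0)) := by
    intro i
    split_ifs with h
    · simp [h]
    · have hneg : μ i - μ 0 < 0 := sub_neg.2 (lt_of_le_of_ne (hμ i) h)
      exact tendsto_exp_atBot.comp (tendsto_id.atTop_mul_const_of_neg hneg)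
  have hZ : Tendsto (fun γ => ∑ i, exp (γ * (μ i - μ 0))) atTop (𝓝 (dMax μ : ℝ)) := by
    have := tendsto_finsetSum Finset.univ fun i _ => hexp i
    rwa [sum_ite_top, mul_one] at this
  have := (hexp j).div hZ hd.ne'
  have e : (if μ j = μ 0 then (1 : ℝ) else 0) / (dMax μ : ℝ)
      = if μ j = μ 0 then 1 / (dMax μ : ℝ) else 0 := by split_ifs <;> simp
  rw [e] at this
  refine this.congr fun γ => ?_
  -- Numerator and denominator are both divided by the dominant term e^{γ μ_0}.
  have hs : ∀ i, exp (γ * (μ i - μ 0)) = exp (γ * μ i) / exp (γ * μ 0) := fun i => by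
    rw [mul_sub, exp_sub]
  simp only [Pi.div_apply, hs, ← Finset.sum_div, gibbs, Z]
  exact div_div_div_cancel_right₀ (exp_pos _).ne' _ _

theorem tendsto_shannon_gibbs_atTop (hμ : ∀ j, μ j ≤ μ 0) :
    Tendsto (fun γ => shannon (gibbs μ γ)) atTop (𝓝 (log (dMax μ))) := by
  rw [← shannon_top]
  exact tendsto_finsetSum _ fun j _ =>
    (continuous_negMulLog.tendsto _).comp (tendsto_gibbs_atTop hμ j)

theorem exists_shannon_gibbs_eq (hμ : ∀ j, μ j ≤ μ 0) {s : ℝ} (hs : log (dMax μ) < s)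
    (hs' : s ≤ log N) : ∃ γ, 0 ≤ γ ∧ shannon (gibbs μ γ) = s := by
  obtain ⟨g, hg0, hg⟩ := ((eventually_ge_atTop (0 : ℝ)).and
    ((tendsto_shannon_gibbs_atTop hμ).eventually_lt_const hs)).exists
  obtain ⟨γ, hγ, h⟩ := intermediate_value_Icc' hg0
    (continuous_shannon_gibbs (μ := μ)).continuousOn
    ⟨hg.le, by simpa only [shannon_gibbs_zero] using hs'⟩
  exact ⟨γ, hγ.1, h⟩

theorem exists_lt_top_of_dMax_lt (hμ : ∀ j, μ j ≤ μ 0) (h : dMax μ < N) : ∃ j, μ j < μ 0 := by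
  by_contra! hc
  have : ∀ j, μ j = μ 0 := fun j => le_antisymm (hμ j) (hc j)
  simp [dMax, this] at h

/-- The maximizing indices of a decreasing vector form an initial segment; the proof compares
cardinalities, j for `Iio j` and j + 1 for `Iic j`. -/
theorem lt_dMax_iff (hμ : Antitone μ) (j : Fin N) : (j : ℕ) < dMax μ ↔ μ j = μ 0 := by
  constructor
  · intro h
    by_contra hne
    have hsub : (Finset.univ.filter fun i : Fin N => μ i = μ 0) ⊆ Finset.Iio j := by
      intro i hi
      rw [Finset.mem_filter] at hi
      rw [Finset.mem_Iio]
      by_contra! hji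
      exact hne (le_antisymm (hμ (Fin.zero_le j)) (hi.2 ▸ hμ hji))
    have := Finset.card_le_card hsub
    rw [Fin.card_Iio] at this
    exact absurd h (not_lt.2 this)
  · intro h
    have hsub : Finset.Iic j ⊆ Finset.univ.filter fun i : Fin N => μ i = μ 0 := by
      intro i hi
      rw [Finset.mem_Iic] at hi
      simp only [Finset.mem_filter, Finset.mem_univ, true_and]
      exact le_antisymm (hμ (Fin.zero_le i)) (h ▸ hμ hi)
    have := Finset.card_le_card hsub
    rw [Fin.card_Iic] at this
    exact this

end Gibbs

/-! ### Abel summation and rearrangement -/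

section Majorization

variable {N : ℕ}

/-- The decrement `f k - f (k + 1)`, where `f` is continued by `0`. -/
def decrement (f : Fin N → ℝ) (k : Fin N) : ℝ :=
  f k - if h : (k : ℕ) + 1 < N then f ⟨k + 1, h⟩ else 0

theorem decrement_nonneg {f : Fin N → ℝ} (hf : Antitone f) (h0 : ∀ i, 0 ≤ f i) (k : Fin N) :
    0 ≤ decrement f k := by
  unfold decrement
  split_ifs with h
  · exact sub_nonneg.2 (hf (Fin.le_def.2 (Nat.le_succ _)))
  · simpa using h0 k

/-- Telescoping, with continuation by 0 past the end. It expands `f` in indicators of initial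
segments, with nonnegative coefficients when `f` is decreasing and nonnegative. -/
theorem sum_decrement (f : Fin N → ℝ) (i : Fin N) :
    ∑ k, (if i ≤ k then decrement f k else 0) = f i := by
  let g : ℕ → ℝ := fun n => if h : n < N then f ⟨n, h⟩ else 0
  have h1 : ∀ k : Fin N, (if i ≤ k then decrement f k else 0)
      = (fun n : ℕ => if (i : ℕ) ≤ n then g n - g (n + 1) else 0) k := by
    intro k
    simp only [decrement, g, Fin.le_def, k.2, dite_true]
  simp_rw [h1]
  rw [Fin.sum_univ_eq_sum_range (fun n : ℕ => if (i : ℕ) ≤ n then g n - g (n + 1) else 0) N,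
    ← Finset.sum_filter]
  have h2 : (Finset.range N).filter (fun n => (i : ℕ) ≤ n) = Finset.Ico (i : ℕ) N := by
    ext n; simp [and_comm]
  rw [h2, ← neg_inj, ← Finset.sum_neg_distrib]
  simp only [neg_sub]
  rw [Finset.sum_Ico_sub g i.2.le]
  simp [g]

/-- A nonnegative matrix whose leading row sums and leading column sums are bounded by those of
`diagonal l` has a smaller pairing with `α i * β j`, for decreasing nonnegative `α` and `β`. -/
theorem sum_mul_mul_le_of_partial_sums {α β l : Fin N → ℝ} {W : Fin N → Fin N → ℝ}
    (hα : Antitone α) (hα0 : ∀ i, 0 ≤ α i) (hβ : Antitone β) (hβ0 : ∀ i, 0 ≤ β i)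
    (hW : ∀ i j, 0 ≤ W i j)
    (hrow : ∀ k, ∑ i ∈ Finset.Iic k, ∑ j, W i j ≤ ∑ i ∈ Finset.Iic k, l i)
    (hcol : ∀ k, ∑ j ∈ Finset.Iic k, ∑ i, W i j ≤ ∑ i ∈ Finset.Iic k, l i) :
    ∑ i, ∑ j, α i * β j * W i j ≤ ∑ i, α i * β i * l i := by
  -- Expanding both α and β in initial segments reduces the claim to leading rectangles of the
  -- matrix.
  have key : ∀ V : Fin N → Fin N → ℝ, ∑ i, ∑ j, α i * β j * V i j
      = ∑ k, ∑ m, decrement α k * decrement β m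
          * ∑ i ∈ Finset.Iic k, ∑ j ∈ Finset.Iic m, V i j := by
    intro V
    have h1 : ∀ i j, α i * β j * V i j = ∑ k, ∑ m, decrement α k * decrement β m
        * (if i ≤ k then if j ≤ m then V i j else 0 else 0) := by
      intro i j
      rw [← sum_decrement α i, ← sum_decrement β j, Finset.sum_mul_sum, Finset.sum_mul]
      refine Finset.sum_congr rfl fun k _ => ?_
      rw [Finset.sum_mul]
      refine Finset.sum_congr rfl fun m _ => ?_
      split_ifs <;> simp
    have h2 : ∀ k m : Fin N, ∑ i ∈ Finset.Iic k, ∑ j ∈ Finset.Iic m, V i j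
        = ∑ i, ∑ j, (if i ≤ k then if j ≤ m then V i j else 0 else 0) := by
      intro k m
      have e : ∀ n : Fin N, Finset.Iic n = Finset.univ.filter (· ≤ n) := fun n => by
        ext; simp
      simp only [e, Finset.sum_filter]
      refine Finset.sum_congr rfl fun i _ => ?_
      split_ifs <;> simp
    simp_rw [h1, h2, Finset.mul_sum]
    calc _ = ∑ i, ∑ k, ∑ j, ∑ m, decrement α k * decrement β m
          * (if i ≤ k then if j ≤ m then V i j else 0 else 0) :=
          Finset.sum_congr rfl fun i _ => Finset.sum_comm
      _ = ∑ k, ∑ i, ∑ j, ∑ m, _ := Finset.sum_comm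
      _ = ∑ k, ∑ i, ∑ m, ∑ j, _ :=
          Finset.sum_congr rfl fun k _ => Finset.sum_congr rfl fun i _ => Finset.sum_comm
      _ = ∑ k, ∑ m, ∑ i, ∑ j, _ := Finset.sum_congr rfl fun k _ => Finset.sum_comm
  have hdiag : ∑ i, α i * β i * l i = ∑ i, ∑ j, α i * β j * (if i = j then l i else 0) := by
    simp
  rw [hdiag, key, key]
  refine Finset.sum_le_sum fun k _ => Finset.sum_le_sum fun m _ =>
    mul_le_mul_of_nonneg_left ?_
      (mul_nonneg (decrement_nonneg hα hα0 k) (decrement_nonneg hβ hβ0 m))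
  -- The leading rectangle of the diagonal matrix sums the first min(k, m) + 1 entries of `l`. The
  -- rectangle of `W` is enlarged to full rows or full columns, whichever are fewer.
  rcases le_total k m with h | h
  · calc ∑ i ∈ Finset.Iic k, ∑ j ∈ Finset.Iic m, W i j
        ≤ ∑ i ∈ Finset.Iic k, ∑ j, W i j := Finset.sum_le_sum fun i _ =>
          Finset.sum_le_sum_of_subset_of_nonneg (Finset.subset_univ _) fun j _ _ => hW i j
      _ ≤ ∑ i ∈ Finset.Iic k, l i := hrow k
      _ = _ := Finset.sum_congr rfl fun i hi => by
          rw [Finset.sum_ite_eq, if_pos (Finset.mem_Iic.2 ((Finset.mem_Iic.1 hi).trans h))]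
  · rw [Finset.sum_comm, Finset.sum_comm (s := Finset.Iic k) (t := Finset.Iic m)]
    calc ∑ j ∈ Finset.Iic m, ∑ i ∈ Finset.Iic k, W i j
        ≤ ∑ j ∈ Finset.Iic m, ∑ i, W i j := Finset.sum_le_sum fun j _ =>
          Finset.sum_le_sum_of_subset_of_nonneg (Finset.subset_univ _) fun i _ _ => hW i j
      _ ≤ ∑ i ∈ Finset.Iic m, l i := hcol m
      _ = _ := Finset.sum_congr rfl fun i hi => by
          rw [Finset.sum_ite_eq', if_pos (Finset.mem_Iic.2 ((Finset.mem_Iic.1 hi).trans h))]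

/-- For decreasing `l`, weights `c j ≤ 1` of total mass `k + 1` are best placed on the first
`k + 1` entries. -/
theorem sum_mul_le_sum_Iic {l c : Fin N → ℝ} (hl : Antitone l) (k : Fin N)
    (h0 : ∀ j, 0 ≤ c j) (h1 : ∀ j, c j ≤ 1) (hsum : ∑ j, c j = (k : ℝ) + 1) :
    ∑ j, l j * c j ≤ ∑ j ∈ Finset.Iic k, l j := by
  -- Subtracting the threshold value `l k` makes the terms up to k nonnegative and the others
  -- nonpositive. The total mass k + 1 then cancels the shift.
  have h2 : ∑ j, (l j - l k) * c j ≤ ∑ j ∈ Finset.Iic k, (l j - l k) := by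
    have e : Finset.Iic k = Finset.univ.filter (· ≤ k) := by ext; simp
    rw [e, Finset.sum_filter]
    refine Finset.sum_le_sum fun j _ => ?_
    split_ifs with h
    · exact mul_le_of_le_one_right (sub_nonneg.2 (hl h)) (h1 j)
    · exact mul_nonpos_of_nonpos_of_nonneg (sub_nonpos.2 (hl (le_of_not_ge h))) (h0 j)
  simp only [sub_mul, Finset.sum_sub_distrib, ← Finset.mul_sum, hsum, Finset.sum_const,
    Fin.card_Iic, nsmul_eq_mul, Nat.cast_add, Nat.cast_one] at h2
  linarith

end Majorization

end PrivacyEnergy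
namespace PrivacyEnergy

open Matrix

/-! ### Sorted eigenvalues, eigenbases and Schur's inequality -/

section Spectral

variable {N : ℕ} {K : Op (Fin N)}

theorem sortedEigenvalue_antitone (hK : K.IsHermitian) : Antitone (sortedEigenvalue hK) :=
  fun _ _ h => hK.eigenvalues₀_antitone (by simpa using h)

/-- The permutation matching `sortedEigenvalue` with `Matrix.IsHermitian.eigenvalues`. -/
noncomputable def sortEquiv (N : ℕ) : Fin N ≃ Fin N :=
  (finCongr (Fintype.card_fin N).symm).trans (Fintype.equivOfCardEq (Fintype.card_fin _))

theorem eigenvalues_sortEquiv (hK : K.IsHermitian) (j : Fin N) :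
    hK.eigenvalues (sortEquiv N j) = sortedEigenvalue hK j := by
  simp [sortEquiv, sortedEigenvalue, IsHermitian.eigenvalues]

theorem exists_isSortedEigenbasis (hK : K.IsHermitian) : ∃ a, IsSortedEigenbasis hK a := by
  refine ⟨hK.eigenvectorBasis.reindex (sortEquiv N).symm, fun j => ?_⟩
  rw [OrthonormalBasis.reindex_apply, Equiv.symm_symm, hK.mulVec_eigenvectorBasis,
    eigenvalues_sortEquiv]
  rfl

theorem sortedEigenvalue_nonneg (hK : K.PosSemidef) (j : Fin N) :
    0 ≤ sortedEigenvalue hK.isHermitian j := by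
  rw [← eigenvalues_sortEquiv]
  exact hK.eigenvalues_nonneg _

theorem sortedEigenvalue_congr {A B : Op (Fin N)} (hA : A.IsHermitian) (hB : B.IsHermitian)
    (h : A.charpoly = B.charpoly) : sortedEigenvalue hA = sortedEigenvalue hB := by
  funext j
  rw [← eigenvalues_sortEquiv, ← eigenvalues_sortEquiv,
    (IsHermitian.eigenvalues_eq_eigenvalues_iff hA hB).2 h]

theorem vonNeumannEntropy_eq_shannon (hK : K.IsHermitian) :
    vonNeumannEntropy hK = shannon (sortedEigenvalue hK) := by
  rw [vonNeumannEntropy, shannon, ← (sortEquiv N).sum_comp, ← Finset.sum_neg_distrib]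
  refine Finset.sum_congr rfl fun j _ => ?_
  rw [eigenvalues_sortEquiv, Real.negMulLog, neg_mul]

theorem sum_sortedEigenvalue (hK : K.IsHermitian) :
    ((∑ j, sortedEigenvalue hK j : ℝ) : ℂ) = K.trace := by
  rw [hK.trace_eq_sum_eigenvalues, Complex.ofReal_sum]
  exact Fintype.sum_equiv (sortEquiv N) _ _ fun j => by rw [eigenvalues_sortEquiv]; rfl

/-- Both sides list the roots of the characteristic polynomial. The comparison is between multisets
because `l` need not be sorted. -/
theorem map_eigenvalues_of_charpoly_eq {ι : Type*} [Fintype ι] [DecidableEq ι] {A : Op ι}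
    (hA : A.IsHermitian) {l : ι → ℝ}
    (h : A.charpoly = (diagonal fun i => (l i : ℂ)).charpoly) :
    Finset.univ.val.map hA.eigenvalues = Finset.univ.val.map l := by
  have h1 := hA.roots_charpoly_eq_eigenvalues
  rw [h, charpoly_diagonal, Polynomial.roots_prod _ _
    (by simp [Finset.prod_ne_zero_iff, Polynomial.X_sub_C_ne_zero])] at h1
  simp only [Polynomial.roots_X_sub_C, Multiset.bind_singleton] at h1
  have h2 := congrArg (Multiset.map Complex.re) h1
  simpa [Multiset.map_map, Function.comp_def] using h2.symm

/-- The unitary matrix whose columns are the vectors of an orthonormal basis. -/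
noncomputable def basisMatrix (a : OrthonormalBasis (Fin N) ℂ (EuclideanSpace ℂ (Fin N))) : Op (Fin N) :=
  Matrix.of fun p j => a j p

variable (a b : OrthonormalBasis (Fin N) ℂ (EuclideanSpace ℂ (Fin N)))

theorem conjTranspose_basisMatrix_mul : (basisMatrix a)ᴴ * basisMatrix a = 1 := by
  ext i j
  have := orthonormal_iff_ite.1 a.orthonormal i j
  rw [PiLp.inner_apply] at this
  rw [Matrix.one_apply, ← this, Matrix.mul_apply]
  refine Finset.sum_congr rfl fun p _ => ?_
  simp [basisMatrix, mul_comm]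

theorem basisMatrix_mul_conjTranspose : basisMatrix a * (basisMatrix a)ᴴ = 1 :=
  mul_eq_one_comm.1 (conjTranspose_basisMatrix_mul a)

variable {a b}

theorem IsSortedEigenbasis.eq_mul_diagonal_mul {hK : K.IsHermitian}
    (h : IsSortedEigenbasis hK a) :
    K = basisMatrix a * diagonal (fun j => (sortedEigenvalue hK j : ℂ)) * (basisMatrix a)ᴴ := by
  have h1 : K * basisMatrix a
      = basisMatrix a * diagonal (fun j => (sortedEigenvalue hK j : ℂ)) := by
    ext p j
    rw [mul_diagonal]
    have := congrFun (h j) p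
    simp only [Pi.smul_apply, smul_eq_mul] at this
    rw [mul_comm]
    exact this
  rw [← h1, Matrix.mul_assoc, basisMatrix_mul_conjTranspose, Matrix.mul_one]

theorem sum_normSq_row (p : Fin N) : ∑ j, Complex.normSq (basisMatrix a p j) = 1 := by
  have := congrFun (congrFun (basisMatrix_mul_conjTranspose a) p) p
  rw [Matrix.mul_apply, Matrix.one_apply_eq] at this
  simp only [conjTranspose_apply, RCLike.star_def, Complex.mul_conj] at this
  exact_mod_cast this

theorem sum_normSq_col (j : Fin N) : ∑ p, Complex.normSq (basisMatrix a p j) = 1 := by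
  have := congrFun (congrFun (conjTranspose_basisMatrix_mul a) j) j
  rw [Matrix.mul_apply, Matrix.one_apply_eq] at this
  simp only [conjTranspose_apply, RCLike.star_def, mul_comm (starRingEnd ℂ _),
    Complex.mul_conj] at this
  exact_mod_cast this

/-- Schur's inequality: leading sums of diagonal entries of a Hermitian matrix are bounded by
sums of its largest eigenvalues. -/
theorem sum_diag_le_sum_sortedEigenvalue (hK : K.IsHermitian) (k : Fin N) :
    ∑ i ∈ Finset.Iic k, (K i i).re ≤ ∑ i ∈ Finset.Iic k, sortedEigenvalue hK i := by
  obtain ⟨a, ha⟩ := exists_isSortedEigenbasis hK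
  -- Each diagonal entry averages the eigenvalues with weights |U_ij|². Since U is unitary, summing
  -- over i ≤ k gives coefficients at most 1 of total mass k + 1.
  have hdiag : ∀ i, (K i i).re
      = ∑ j, sortedEigenvalue hK j * Complex.normSq (basisMatrix a i j) := by
    intro i
    conv_lhs => rw [ha.eq_mul_diagonal_mul]
    rw [Matrix.mul_apply, Complex.re_sum]
    refine Finset.sum_congr rfl fun j _ => ?_
    rw [mul_diagonal, conjTranspose_apply, RCLike.star_def, mul_right_comm, Complex.mul_conj,
      ← Complex.ofReal_mul, Complex.ofReal_re, mul_comm]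
  simp_rw [hdiag]
  rw [Finset.sum_comm]
  simp_rw [← Finset.mul_sum]
  refine sum_mul_le_sum_Iic (sortedEigenvalue_antitone hK) k
    (fun j => Finset.sum_nonneg fun _ _ => Complex.normSq_nonneg _) (fun j => ?_) ?_
  · rw [← sum_normSq_col (a := a) j]
    exact Finset.sum_le_sum_of_subset_of_nonneg (Finset.subset_univ _)
      fun _ _ _ => Complex.normSq_nonneg _
  · rw [Finset.sum_comm]
    simp [sum_normSq_row]

end Spectral

/-! ### Bipartite kets as coefficient matrices -/

section Coefficients

variable {N : ℕ}

/-- The coefficients of a bipartite ket, as a matrix from the first to the second factor. -/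
def coeffMatrix (ψ : EuclideanSpace ℂ (Fin N × Fin N)) : Op (Fin N) :=
  Matrix.of fun q p => ψ (p, q)

/-- The coefficients of a bipartite ket in the product basis of `a` and `b`. -/
noncomputable def coeffIn (a b : OrthonormalBasis (Fin N) ℂ (EuclideanSpace ℂ (Fin N)))
    (ψ : EuclideanSpace ℂ (Fin N × Fin N)) : Op (Fin N) :=
  (basisMatrix b)ᴴ * coeffMatrix ψ * (basisMatrix a)ᵀᴴ

variable (a b : OrthonormalBasis (Fin N) ℂ (EuclideanSpace ℂ (Fin N)))
  (ψ : EuclideanSpace ℂ (Fin N × Fin N))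

theorem transpose_basisMatrix_mul : (basisMatrix a)ᵀ * (basisMatrix a)ᵀᴴ = 1 := by
  have := congrArg transpose (conjTranspose_basisMatrix_mul a)
  rw [transpose_mul, transpose_one] at this
  exact this

theorem conjTranspose_transpose_basisMatrix_mul : (basisMatrix a)ᵀᴴ * (basisMatrix a)ᵀ = 1 :=
  mul_eq_one_comm.1 (transpose_basisMatrix_mul a)

theorem coeffMatrix_eq :
    coeffMatrix ψ = basisMatrix b * coeffIn a b ψ * (basisMatrix a)ᵀ := by
  simp only [coeffIn, Matrix.mul_assoc, conjTranspose_transpose_basisMatrix_mul, Matrix.mul_one]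
  rw [← Matrix.mul_assoc, basisMatrix_mul_conjTranspose, Matrix.one_mul]

theorem partialTraceB_vecMulVec :
    partialTraceB (vecMulVec ψ.ofLp (star ψ.ofLp)) = ((coeffMatrix ψ)ᴴ * coeffMatrix ψ)ᵀ := by
  ext i i'
  simp only [partialTraceB, vecMulVec_apply, Matrix.of_apply, transpose_apply, Matrix.mul_apply,
    conjTranspose_apply, coeffMatrix, Pi.star_apply]
  exact Finset.sum_congr rfl fun j _ => mul_comm _ _

theorem coeffMatrix_conjTranspose_mul :
    (coeffMatrix ψ)ᴴ * coeffMatrix ψ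
      = (basisMatrix a)ᵀᴴ * ((coeffIn a b ψ)ᴴ * coeffIn a b ψ) * (basisMatrix a)ᵀ := by
  rw [coeffMatrix_eq a b ψ]
  simp only [conjTranspose_mul, Matrix.mul_assoc]
  rw [← Matrix.mul_assoc (basisMatrix b)ᴴ, conjTranspose_basisMatrix_mul, Matrix.one_mul]

/-- The reduced state is the transpose of a unitary conjugate of Yᴴ Y, and the characteristic
polynomial sees neither change. -/
theorem charpoly_partialTraceB :
    (partialTraceB (vecMulVec ψ.ofLp (star ψ.ofLp))).charpoly
      = ((coeffIn a b ψ)ᴴ * coeffIn a b ψ).charpoly := by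
  rw [partialTraceB_vecMulVec, charpoly_transpose, coeffMatrix_conjTranspose_mul a b,
    charpoly_mul_comm, ← Matrix.mul_assoc, transpose_basisMatrix_mul, Matrix.one_mul]

theorem trace_partialTraceB (ρ : Op (Fin N × Fin N)) : (partialTraceB ρ).trace = ρ.trace := by
  simp [partialTraceB, Matrix.trace, Fintype.sum_prod_type]

theorem trace_coeffIn :
    (vecMulVec ψ.ofLp (star ψ.ofLp)).trace = ((coeffIn a b ψ)ᴴ * coeffIn a b ψ).trace := by
  rw [← trace_partialTraceB, partialTraceB_vecMulVec, trace_transpose,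
    coeffMatrix_conjTranspose_mul a b, trace_mul_comm, ← Matrix.mul_assoc,
    transpose_basisMatrix_mul, Matrix.one_mul]

theorem conjTranspose_mul_self_apply_re (Y : Op (Fin N)) (i : Fin N) :
    ((Yᴴ * Y) i i).re = ∑ j, Complex.normSq (Y j i) := by
  rw [Matrix.mul_apply, Complex.re_sum]
  refine Finset.sum_congr rfl fun j _ => ?_
  rw [conjTranspose_apply, RCLike.star_def, mul_comm, Complex.mul_conj, Complex.ofReal_re]

theorem mul_conjTranspose_self_apply_re (Y : Op (Fin N)) (j : Fin N) :
    ((Y * Yᴴ) j j).re = ∑ i, Complex.normSq (Y j i) := by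
  rw [Matrix.mul_apply, Complex.re_sum]
  refine Finset.sum_congr rfl fun i _ => ?_
  rw [conjTranspose_apply, RCLike.star_def, Complex.mul_conj, Complex.ofReal_re]

variable {Ka Kb : Op (Fin N)} {a b}

theorem energy_eq_trace :
    energy (Ka ⊗ₖ Kb) ψ = ((coeffMatrix ψ)ᴴ * (Kb * coeffMatrix ψ * Kaᵀ)).trace.re := by
  -- Rows of `coeffMatrix` are indexed by the second factor, so its column-stacked `vec` is
  -- definitionally ψ, and Ka ⊗ Kb acts by X ↦ Kb X Kaᵀ.
  have : ψ.ofLp = vec (coeffMatrix ψ) := rfl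
  rw [energy, this, kronecker_mulVec_vec, star_vec_dotProduct_vec]

theorem trace_diagonal_weights (Y : Op (Fin N)) (α β : Fin N → ℝ) :
    (Yᴴ * (diagonal (fun j => (β j : ℂ)) * Y * diagonal (fun i => (α i : ℂ)))).trace.re
      = ∑ i, ∑ j, α i * β j * Complex.normSq (Y j i) := by
  simp only [Matrix.trace, diag_apply, Complex.re_sum]
  refine Finset.sum_congr rfl fun i _ => ?_
  rw [Matrix.mul_apply, Complex.re_sum]
  refine Finset.sum_congr rfl fun j _ => ?_
  rw [mul_diagonal, diagonal_mul, conjTranspose_apply, RCLike.star_def]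
  have : (starRingEnd ℂ) (Y j i) * (β j * Y j i * α i)
      = ((α i * β j * Complex.normSq (Y j i) : ℝ) : ℂ) := by
    push_cast
    rw [← Complex.mul_conj]
    ring
  rw [this, Complex.ofReal_re]

theorem energy_eq_sum {hKa : Ka.IsHermitian} {hKb : Kb.IsHermitian}
    (ha : IsSortedEigenbasis hKa a) (hb : IsSortedEigenbasis hKb b) :
    energy (Ka ⊗ₖ Kb) ψ = ∑ i, ∑ j, sortedEigenvalue hKa i * sortedEigenvalue hKb j
      * Complex.normSq (coeffIn a b ψ j i) := by
  rw [energy_eq_trace, ← trace_diagonal_weights]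
  have hKaT : Kaᵀ = (basisMatrix a)ᵀᴴ * diagonal (fun j => (sortedEigenvalue hKa j : ℂ))
      * (basisMatrix a)ᵀ := by
    conv_lhs => rw [ha.eq_mul_diagonal_mul]
    rw [transpose_mul, transpose_mul, diagonal_transpose, Matrix.mul_assoc]
    rfl
  have hleft : (basisMatrix b)ᴴ * coeffMatrix ψ = coeffIn a b ψ * (basisMatrix a)ᵀ := by
    rw [coeffMatrix_eq a b ψ, Matrix.mul_assoc, ← Matrix.mul_assoc,
      conjTranspose_basisMatrix_mul, Matrix.one_mul]
  congr 1
  set Da := diagonal (fun j => (sortedEigenvalue hKa j : ℂ))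
  set Db := diagonal (fun j => (sortedEigenvalue hKb j : ℂ))
  calc ((coeffMatrix ψ)ᴴ * (Kb * coeffMatrix ψ * Kaᵀ)).trace
      = (((basisMatrix b)ᴴ * coeffMatrix ψ)ᴴ * (Db * ((basisMatrix b)ᴴ * coeffMatrix ψ)
          * ((basisMatrix a)ᵀᴴ * Da * (basisMatrix a)ᵀ))).trace := by
        rw [hKaT, hb.eq_mul_diagonal_mul]
        simp only [conjTranspose_mul, conjTranspose_conjTranspose, Matrix.mul_assoc]
        rfl
    _ = ((basisMatrix a)ᵀᴴ * ((coeffIn a b ψ)ᴴ * (Db * coeffIn a b ψ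
          * ((basisMatrix a)ᵀ * (basisMatrix a)ᵀᴴ) * Da)) * (basisMatrix a)ᵀ).trace := by
        rw [hleft]
        simp only [conjTranspose_mul, Matrix.mul_assoc]
    _ = ((coeffIn a b ψ)ᴴ * (Db * coeffIn a b ψ * Da)).trace := by
        rw [transpose_basisMatrix_mul, Matrix.mul_one, trace_mul_comm, ← Matrix.mul_assoc,
          transpose_basisMatrix_mul, Matrix.one_mul]

/-- The energy is bounded by the pairing of the sorted Schmidt weights with the products of the
sorted eigenvalues. -/
theorem energy_le_sum_sortedEigenvalue (hKa : Ka.PosSemidef) (hKb : Kb.PosSemidef)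
    (hρ : (vecMulVec ψ.ofLp (star ψ.ofLp)).IsHermitian) :
    energy (Ka ⊗ₖ Kb) ψ ≤ ∑ i, sortedEigenvalue hKa.isHermitian i *
      sortedEigenvalue hKb.isHermitian i * sortedEigenvalue (isHermitian_partialTraceB hρ) i := by
  obtain ⟨a, ha⟩ := exists_isSortedEigenbasis hKa.isHermitian
  obtain ⟨b, hb⟩ := exists_isSortedEigenbasis hKb.isHermitian
  -- The reduced state, Yᴴ Y and Y Yᴴ have the same characteristic polynomial, so one list of sorted
  -- eigenvalues serves in both applications of Schur's inequality.
  have hrow := sortedEigenvalue_congr (isHermitian_partialTraceB hρ)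
    (isHermitian_conjTranspose_mul_self (coeffIn a b ψ)) (charpoly_partialTraceB a b ψ)
  have hcol := sortedEigenvalue_congr (isHermitian_partialTraceB hρ)
    (isHermitian_mul_conjTranspose_self (coeffIn a b ψ))
    ((charpoly_partialTraceB a b ψ).trans (charpoly_mul_comm _ _))
  rw [energy_eq_sum ψ ha hb]
  refine sum_mul_mul_le_of_partial_sums
    (sortedEigenvalue_antitone _) (sortedEigenvalue_nonneg hKa)
    (sortedEigenvalue_antitone _) (sortedEigenvalue_nonneg hKb)
    (fun _ _ => Complex.normSq_nonneg _) (fun k => ?_) fun k => ?_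
  · rw [hrow]
    simp_rw [← conjTranspose_mul_self_apply_re]
    exact sum_diag_le_sum_sortedEigenvalue _ k
  · rw [hcol]
    simp_rw [← mul_conjTranspose_self_apply_re]
    exact sum_diag_le_sum_sortedEigenvalue _ k

theorem coeffIn_schmidtState (l : Fin N → ℝ) :
    coeffIn a b (schmidtState a b l) = diagonal fun j => (Real.sqrt (l j) : ℂ) := by
  have : coeffMatrix (schmidtState a b l)
      = basisMatrix b * (diagonal fun j => (Real.sqrt (l j) : ℂ)) * (basisMatrix a)ᵀ := by
    ext q p
    rw [Matrix.mul_apply]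
    simp only [mul_diagonal, coeffMatrix, schmidtState, Matrix.of_apply, transpose_apply,
      basisMatrix]
    exact Finset.sum_congr rfl fun j _ => by ring
  rw [coeffIn, this]
  simp only [Matrix.mul_assoc, transpose_basisMatrix_mul, Matrix.mul_one]
  rw [← Matrix.mul_assoc, conjTranspose_basisMatrix_mul, Matrix.one_mul]

theorem energy_schmidtState {hKa : Ka.IsHermitian} {hKb : Kb.IsHermitian}
    (ha : IsSortedEigenbasis hKa a) (hb : IsSortedEigenbasis hKb b) {l : Fin N → ℝ}
    (hl : ∀ j, 0 ≤ l j) :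
    energy (Ka ⊗ₖ Kb) (schmidtState a b l)
      = ∑ j, l j * (sortedEigenvalue hKa j * sortedEigenvalue hKb j) := by
  rw [energy_eq_sum _ ha hb, coeffIn_schmidtState]
  refine Finset.sum_congr rfl fun i _ => ?_
  rw [Finset.sum_eq_single i (fun j _ hj => by simp [diagonal_apply_ne _ hj]) (by simp),
    diagonal_apply_eq, Complex.normSq_ofReal, Real.mul_self_sqrt (hl i), mul_comm]

theorem conjTranspose_mul_diagonal_sqrt {l : Fin N → ℝ} (hl : ∀ j, 0 ≤ l j) :
    (diagonal fun j => (Real.sqrt (l j) : ℂ))ᴴ * (diagonal fun j => (Real.sqrt (l j) : ℂ))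
      = diagonal fun j => (l j : ℂ) := by
  rw [diagonal_conjTranspose, diagonal_mul_diagonal]
  congr 1
  funext j
  rw [Pi.star_apply, RCLike.star_def, Complex.conj_ofReal, ← Complex.ofReal_mul,
    Real.mul_self_sqrt (hl j)]

theorem shannon_schmidtState {l : Fin N → ℝ} (hl : ∀ j, 0 ≤ l j)
    (hρ : (vecMulVec (schmidtState a b l).ofLp (star (schmidtState a b l).ofLp)).IsHermitian) :
    entanglementEntropy hρ = shannon l := by
  have h := charpoly_partialTraceB a b (schmidtState a b l)
  rw [coeffIn_schmidtState, conjTranspose_mul_diagonal_sqrt hl] at h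
  have h1 := congrArg (fun m => (m.map Real.negMulLog).sum)
    (map_eigenvalues_of_charpoly_eq (isHermitian_partialTraceB hρ) h)
  simp only [Multiset.map_map] at h1
  rw [entanglementEntropy, vonNeumannEntropy, ← Finset.sum_neg_distrib]
  simp only [← neg_mul]
  exact h1

theorem schmidtState_mem_kets {l : Fin N → ℝ} (hl : ∀ j, 0 ≤ l j) (h1 : ∑ j, l j = 1) {s : ℝ}
    (hs : s ≤ shannon l) : schmidtState a b l ∈ kets N s := by
  set ψ := schmidtState a b l with hψ
  have htr : (vecMulVec ψ.ofLp (star ψ.ofLp)).trace = 1 := by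
    rw [trace_coeffIn a b, hψ, coeffIn_schmidtState, conjTranspose_mul_diagonal_sqrt hl,
      trace_diagonal]
    exact_mod_cast h1
  refine ⟨posSemidef_vecMulVec_self_star _, htr, ?_, ?_⟩
  -- An outer product has rank at most 1, and rank 0 would contradict trace 1.
  · refine le_antisymm (rank_vecMulVec_le _ _) (Nat.one_le_iff_ne_zero.2 fun h => ?_)
    rw [Matrix.rank, Submodule.finrank_eq_zero, LinearMap.range_eq_bot, ← mulVecLin_zero] at h
    rw [Matrix.toLin'.injective h, trace_zero] at htr
    exact zero_ne_one htr
  · rw [shannon_schmidtState hl]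
    exact hs

/-- The energy of a ket in `ℍ_s` is bounded by the mean of the products of the sorted eigenvalues
under some probability vector of entropy at least `s`. -/
theorem exists_weights_of_mem_kets (hKa : Ka.PosSemidef) (hKb : Kb.PosSemidef) {s : ℝ}
    {ψ : EuclideanSpace ℂ (Fin N × Fin N)} (hψ : ψ ∈ kets N s) :
    ∃ l : Fin N → ℝ, (∀ j, 0 ≤ l j) ∧ ∑ j, l j = 1 ∧ s ≤ shannon l ∧
      energy (Ka ⊗ₖ Kb) ψ ≤ ∑ j, l j *
        (sortedEigenvalue hKa.isHermitian j * sortedEigenvalue hKb.isHermitian j) := by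
  obtain ⟨hρ, htr, -, hs⟩ := hψ
  have hpos : (partialTraceB (vecMulVec ψ.ofLp (star ψ.ofLp))).PosSemidef := by
    rw [partialTraceB_vecMulVec]
    exact (posSemidef_conjTranspose_mul_self _).transpose
  refine ⟨sortedEigenvalue (isHermitian_partialTraceB hρ.isHermitian),
    sortedEigenvalue_nonneg hpos, ?_, ?_, ?_⟩
  · have := sum_sortedEigenvalue (isHermitian_partialTraceB hρ.isHermitian)
    rw [trace_partialTraceB, htr] at this
    exact_mod_cast this
  · rwa [entanglementEntropy, vonNeumannEntropy_eq_shannon] at hs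
  · refine (energy_le_sum_sortedEigenvalue ψ hKa hKb hρ.isHermitian).trans_eq ?_
    exact Finset.sum_congr rfl fun j _ => mul_comm _ _

end Coefficients

/-! ### Positivity and the top eigenvalue of the product -/

theorem posSemidef_inducedObservable {κ O : Type*} [Fintype κ] [Fintype O] {N : ℕ}
    (E : QuantumChannel κ N) (M : POVM O N) (o : O) : (inducedObservable E M o).PosSemidef :=
  posSemidef_sum _ fun k _ => (M.posSemidef o).conjTranspose_mul_mul_same (E.kraus k)

/-- The product of the two eigenbases diagonalizes Ka ⊗ Kb with eigenvalues α_i β_j; nonnegativity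
puts the largest at the two top indices. -/
theorem sigmaMax_kronecker {N : ℕ} [NeZero N] {Ka Kb : Op (Fin N)} (hKa : Ka.PosSemidef)
    (hKb : Kb.PosSemidef) :
    sigmaMax (Ka ⊗ₖ Kb)
      = sortedEigenvalue hKa.isHermitian 0 * sortedEigenvalue hKb.isHermitian 0 := by
  obtain ⟨a, ha⟩ := exists_isSortedEigenbasis hKa.isHermitian
  obtain ⟨b, hb⟩ := exists_isSortedEigenbasis hKb.isHermitian
  have hK : (Ka ⊗ₖ Kb).IsHermitian := (hKa.kronecker hKb).isHermitian
  have hchar : (Ka ⊗ₖ Kb).charpoly = (diagonal fun p : Fin N × Fin N =>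
      ((sortedEigenvalue hKa.isHermitian p.1 * sortedEigenvalue hKb.isHermitian p.2 : ℝ) : ℂ)
      ).charpoly := by
    conv_lhs => rw [ha.eq_mul_diagonal_mul, hb.eq_mul_diagonal_mul]
    rw [mul_kronecker_mul, mul_kronecker_mul, charpoly_mul_comm, ← Matrix.mul_assoc,
      ← mul_kronecker_mul, conjTranspose_basisMatrix_mul, conjTranspose_basisMatrix_mul,
      one_kronecker_one, Matrix.one_mul, diagonal_kronecker_diagonal]
    simp only [Complex.ofReal_mul]
  have hspec : spectrum ℝ (Ka ⊗ₖ Kb) = Set.range fun p : Fin N × Fin N =>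
      sortedEigenvalue hKa.isHermitian p.1 * sortedEigenvalue hKb.isHermitian p.2 := by
    rw [hK.spectrum_real_eq_range_eigenvalues]
    ext x
    have := congrArg (x ∈ ·) (map_eigenvalues_of_charpoly_eq hK hchar)
    simpa using this
  rw [sigmaMax, hspec]
  refine IsGreatest.csSup_eq ⟨⟨(0, 0), rfl⟩, ?_⟩
  rintro _ ⟨p, rfl⟩
  exact mul_le_mul (sortedEigenvalue_antitone _ (Fin.zero_le _))
    (sortedEigenvalue_antitone _ (Fin.zero_le _)) (sortedEigenvalue_nonneg hKb _)
    (sortedEigenvalue_nonneg hKa _)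

end PrivacyEnergy
namespace PrivacyEnergy

/-! ### Reduction to the classical problem and the optimum -/

section Optimal

variable {N : ℕ} {Ka Kb : Op (Fin N)}

/-- Weights that solve the classical problem of maximizing the mean of `μ` under an entropy
constraint solve the problem over entangled states. -/
theorem isOptimalWeight_of_maximizes (hKa : Ka.PosSemidef) (hKb : Kb.PosSemidef) {μ : Fin N → ℝ}
    (hμ : ∀ j, μ j = sortedEigenvalue hKa.isHermitian j * sortedEigenvalue hKb.isHermitian j)
    {s : ℝ} {l : Fin N → ℝ} (h0 : ∀ j, 0 ≤ l j) (h1 : ∑ j, l j = 1) (hs : s ≤ shannon l)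
    (hmax : ∀ l' : Fin N → ℝ, (∀ j, 0 ≤ l' j) → ∑ j, l' j = 1 → s ≤ shannon l' →
      ∑ j, l' j * μ j ≤ ∑ j, l j * μ j) :
    IsOptimalWeight hKa.isHermitian hKb.isHermitian s l ∧
      IsGreatest (energy (Ka ⊗ₖ Kb) '' kets N s) (∑ j, l j * μ j) := by
  have hbound : ∀ ψ ∈ kets N s, energy (Ka ⊗ₖ Kb) ψ ≤ ∑ j, l j * μ j := by
    intro ψ hψ
    obtain ⟨l', h0', h1', hs', he⟩ := exists_weights_of_mem_kets hKa hKb hψ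
    simp_rw [← hμ] at he
    exact he.trans (hmax l' h0' h1' hs')
  have henergy : ∀ a b, IsSortedEigenbasis hKa.isHermitian a →
      IsSortedEigenbasis hKb.isHermitian b →
      energy (Ka ⊗ₖ Kb) (schmidtState a b l) = ∑ j, l j * μ j := by
    intro a b ha hb
    rw [energy_schmidtState ha hb h0]
    simp_rw [hμ]
  refine ⟨⟨h0, h1, fun a b ha hb => ⟨schmidtState_mem_kets h0 h1 hs, fun ψ hψ => ?_⟩⟩, ?_, ?_⟩
  · rw [Set.mem_ofPred_eq, henergy a b ha hb]
    exact hbound ψ hψ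
  · obtain ⟨a, ha⟩ := exists_isSortedEigenbasis hKa.isHermitian
    obtain ⟨b, hb⟩ := exists_isSortedEigenbasis hKb.isHermitian
    exact ⟨_, schmidtState_mem_kets h0 h1 hs, henergy a b ha hb⟩
  · rintro _ ⟨ψ, hψ, rfl⟩
    exact hbound ψ hψ

end Optimal

/-- The maximal energy of a product of positive operators over entangled states. -/
theorem privacyEnergy_optimum {N : ℕ} [NeZero N] {Ka Kb : Op (Fin N)}
    (hKa : Ka.PosSemidef) (hKb : Kb.PosSemidef) {μ : Fin N → ℝ}
    (hμ : ∀ j, μ j = sortedEigenvalue hKa.isHermitian j * sortedEigenvalue hKb.isHermitian j) :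
    (∀ s : ℝ, s ≤ Real.log N →
      IsGreatest (energy (Ka ⊗ₖ Kb) '' kets N s) (Jmax (Ka ⊗ₖ Kb) s)) ∧
    (∀ s : ℝ, s ≤ Real.log (dMax μ) →
      Jmax (Ka ⊗ₖ Kb) s = μ 0 ∧ μ 0 = sigmaMax (Ka ⊗ₖ Kb) ∧
      IsOptimalWeight hKa.isHermitian hKb.isHermitian s
        (fun j => if (j : ℕ) < dMax μ then 1 / (dMax μ : ℝ) else 0)) ∧
    (∀ s : ℝ, Real.log (dMax μ) < s → s ≤ Real.log N →
      ∃ γ : ℝ, 0 ≤ γ ∧ (0 < γ ↔ s < Real.log N) ∧ EntropyEq μ s γ ∧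
        (∀ γ' : ℝ, 0 ≤ γ' → EntropyEq μ s γ' → γ' = γ) ∧
        Jmax (Ka ⊗ₖ Kb) s = 1 / Z μ γ * ∑ j, μ j * Real.exp (γ * μ j) ∧
        Jmax (Ka ⊗ₖ Kb) s < sigmaMax (Ka ⊗ₖ Kb) ∧
        IsOptimalWeight hKa.isHermitian hKb.isHermitian s
          (fun j => Real.exp (γ * μ j) / Z μ γ)) ∧
    StrictAntiOn (Jmax (Ka ⊗ₖ Kb)) (Set.Icc (Real.log (dMax μ)) (Real.log N)) := by
  have hanti : Antitone μ := fun i j h => by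
    rw [hμ, hμ]
    exact mul_le_mul (sortedEigenvalue_antitone _ h) (sortedEigenvalue_antitone _ h)
      (sortedEigenvalue_nonneg hKb _) (sortedEigenvalue_nonneg hKa _)
  have htop : ∀ j, μ j ≤ μ 0 := fun j => hanti (Fin.zero_le j)
  have hσ : μ 0 = sigmaMax (Ka ⊗ₖ Kb) := by rw [sigmaMax_kronecker hKa hKb, hμ]
  have hd : (0 : ℝ) < dMax μ := by exact_mod_cast dMax_pos (μ := μ)
  -- the low-entanglement regime
  have low : ∀ s, s ≤ Real.log (dMax μ) →
      IsOptimalWeight hKa.isHermitian hKb.isHermitian s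
        (fun j => if (j : ℕ) < dMax μ then 1 / (dMax μ : ℝ) else 0) ∧
      IsGreatest (energy (Ka ⊗ₖ Kb) '' kets N s) (μ 0) := by
    intro s hs
    simp_rw [lt_dMax_iff hanti]
    have hmean : ∑ j, (if μ j = μ 0 then 1 / (dMax μ : ℝ) else 0) * μ j = μ 0 := by
      have : ∀ j, (if μ j = μ 0 then 1 / (dMax μ : ℝ) else 0) * μ j
          = if μ j = μ 0 then 1 / (dMax μ : ℝ) * μ 0 else 0 := fun j => by
        split_ifs with h
        · rw [h]
        · rw [zero_mul]
      simp_rw [this, sum_ite_top]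
      field_simp
    have := isOptimalWeight_of_maximizes hKa hKb hμ (s := s)
      (l := fun j => if μ j = μ 0 then 1 / (dMax μ : ℝ) else 0)
      (fun j => by split_ifs <;> positivity) (by rw [sum_ite_top]; field_simp)
      (by rwa [shannon_top]) (fun l' h0 h1 _ => by
        rw [hmean]
        calc ∑ j, l' j * μ j ≤ ∑ j, l' j * μ 0 :=
              Finset.sum_le_sum fun j _ => mul_le_mul_of_nonneg_left (htop j) (h0 j)
          _ = μ 0 := by rw [← Finset.sum_mul, h1, one_mul])
    rwa [hmean] at this
  -- the high-entanglement regime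
  have high : ∀ γ, 0 ≤ γ →
      IsOptimalWeight hKa.isHermitian hKb.isHermitian (shannon (gibbs μ γ)) (gibbs μ γ) ∧
      IsGreatest (energy (Ka ⊗ₖ Kb) '' kets N (shannon (gibbs μ γ)))
        (∑ j, gibbs μ γ j * μ j) := fun γ hγ =>
    isOptimalWeight_of_maximizes hKa hKb hμ (fun j => (gibbs_pos μ γ j).le) (sum_gibbs μ γ) le_rfl
      fun l' h0 h1 hs => sum_mul_le_of_shannon_le h0 h1 hγ hs
  have hJlow : ∀ s, s ≤ Real.log (dMax μ) → Jmax (Ka ⊗ₖ Kb) s = μ 0 := fun s hs =>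
    (low s hs).2.csSup_eq
  have hJhigh : ∀ γ, 0 ≤ γ →
      Jmax (Ka ⊗ₖ Kb) (shannon (gibbs μ γ)) = ∑ j, gibbs μ γ j * μ j := fun γ hγ =>
    (high γ hγ).2.csSup_eq
  have hex : ∀ s, Real.log (dMax μ) < s → s ≤ Real.log N → ∃ i, μ i < μ 0 := by
    intro s h h'
    refine exists_lt_top_of_dMax_lt htop ?_
    have := (Real.log_lt_log_iff hd (by exact_mod_cast NeZero.pos N)).1 (h.trans_le h')
    exact_mod_cast this
  have hlt : ∀ s, Real.log (dMax μ) < s → s ≤ Real.log N → Jmax (Ka ⊗ₖ Kb) s < μ 0 := by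
    intro s h h'
    obtain ⟨γ, hγ, rfl⟩ := exists_shannon_gibbs_eq htop h h'
    obtain ⟨i, hi⟩ := hex _ h h'
    rw [hJhigh γ hγ]
    exact sum_gibbs_mul_lt htop hi γ
  refine ⟨fun s hs => ?_, fun s hs => ⟨hJlow s hs, hσ, (low s hs).1⟩, fun s h h' => ?_, ?_⟩
  · rcases le_or_gt s (Real.log (dMax μ)) with h | h
    · rw [hJlow s h]
      exact (low s h).2
    · obtain ⟨γ, hγ, rfl⟩ := exists_shannon_gibbs_eq htop h hs
      rw [hJhigh γ hγ]
      exact (high γ hγ).2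
  · have hJ := hlt s h h'
    obtain ⟨i, hi⟩ := hex s h h'
    obtain ⟨γ, hγ, rfl⟩ := exists_shannon_gibbs_eq htop h h'
    have hinj := shannon_gibbs_injOn hi.ne
    refine ⟨γ, hγ, ⟨fun hpos => lt_of_le_of_ne h' fun he => ?_, fun hs => ?_⟩,
      (entropyEq_iff _ _ _).2 rfl, fun γ' hγ' he => ?_, ?_, hσ ▸ hJ, (high γ hγ).1⟩
    · rw [← shannon_gibbs_zero (μ := μ)] at he
      exact hpos.ne' (hinj hγ (Set.mem_Ici.2 le_rfl) he)
    · refine lt_of_le_of_ne hγ fun he => ?_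
      rw [← he, shannon_gibbs_zero] at hs
      exact lt_irrefl _ hs
    · exact hinj hγ' hγ ((entropyEq_iff _ _ _).1 he)
    · rw [hJhigh γ hγ, sum_gibbs_mul]
  · intro s hs t ht hst
    have hdt := hs.1.trans_lt hst
    -- At the left endpoint the value is still μ_0, which is not reached at t. Otherwise both s and
    -- t are Gibbs entropies, and s < t ≤ log N forces γ > 0, which makes the comparison of means
    -- strict.
    rcases hs.1.eq_or_lt with h | h
    · rw [hJlow s h.ge]
      exact hlt t hdt ht.2
    · obtain ⟨γ, hγ, rfl⟩ := exists_shannon_gibbs_eq htop h hs.2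
      obtain ⟨γ', hγ', rfl⟩ := exists_shannon_gibbs_eq htop hdt ht.2
      have hpos : 0 < γ := lt_of_le_of_ne hγ fun he => by
        rw [← he, shannon_gibbs_zero] at hst
        exact absurd ht.2 (not_le.2 hst)
      rw [hJhigh γ hγ, hJhigh γ' hγ']
      exact sum_mul_lt_of_shannon_lt (fun j => (gibbs_pos μ γ' j).le) (sum_gibbs μ γ') hpos hst

end PrivacyEnergy

theorem mainTheorem1 {N : ℕ} [NeZero N] {κA κB OA OB : Type*}
    [Fintype κA] [Fintype κB] [Fintype OA] [Fintype OB]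
    (EA : PrivacyEnergy.QuantumChannel κA N) (EB : PrivacyEnergy.QuantumChannel κB N)
    (MA : PrivacyEnergy.POVM OA N) (MB : PrivacyEnergy.POVM OB N) (a : OA) (b : OB)
    (K : PrivacyEnergy.Op (Fin N × Fin N))
    (hK : K = PrivacyEnergy.inducedObservable EA MA a ⊗ₖ PrivacyEnergy.inducedObservable EB MB b)
    (μ : Fin N → ℝ)
    (hμ : ∀ j, μ j =
      PrivacyEnergy.sortedEigenvalue (PrivacyEnergy.isHermitian_inducedObservable EA MA a) j *
      PrivacyEnergy.sortedEigenvalue (PrivacyEnergy.isHermitian_inducedObservable EB MB b) j)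
    (d : ℕ) (hd : d = PrivacyEnergy.dMax μ) :
    -- the maximum defining `Jmax` is attained
    (∀ s : ℝ, s ≤ Real.log N →
      IsGreatest (PrivacyEnergy.energy K '' PrivacyEnergy.kets N s) (PrivacyEnergy.Jmax K s)) ∧
    -- low-entanglement regime
    (∀ s : ℝ, s ≤ Real.log d →
      PrivacyEnergy.Jmax K s = μ 0 ∧ μ 0 = PrivacyEnergy.sigmaMax K ∧
      PrivacyEnergy.IsOptimalWeight (PrivacyEnergy.isHermitian_inducedObservable EA MA a)
          (PrivacyEnergy.isHermitian_inducedObservable EB MB b) s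
        (fun j => if (j : ℕ) < d then 1 / (d : ℝ) else 0)) ∧
    -- high-entanglement regime
    (∀ s : ℝ, Real.log d < s → s ≤ Real.log N →
      ∃ γ : ℝ, 0 ≤ γ ∧ (0 < γ ↔ s < Real.log N) ∧
        PrivacyEnergy.EntropyEq μ s γ ∧
        (∀ γ' : ℝ, 0 ≤ γ' → PrivacyEnergy.EntropyEq μ s γ' → γ' = γ) ∧
        PrivacyEnergy.Jmax K s
          = 1 / PrivacyEnergy.Z μ γ * ∑ j, μ j * Real.exp (γ * μ j) ∧
        PrivacyEnergy.Jmax K s < PrivacyEnergy.sigmaMax K ∧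
        PrivacyEnergy.IsOptimalWeight (PrivacyEnergy.isHermitian_inducedObservable EA MA a)
          (PrivacyEnergy.isHermitian_inducedObservable EB MB b) s
          (fun j => Real.exp (γ * μ j) / PrivacyEnergy.Z μ γ)) ∧
    -- strict monotonicity in `s`
    StrictAntiOn (PrivacyEnergy.Jmax K) (Set.Icc (Real.log d) (Real.log N)) := by
  subst hK hd
  exact PrivacyEnergy.privacyEnergy_optimum (PrivacyEnergy.posSemidef_inducedObservable EA MA a)
    (PrivacyEnergy.posSemidef_inducedObservable EB MB b) hμ
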